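/- All graphs are finite and simple. The Euler genus of a closed connected surface $\Sigma$ (orientable or not) is $2-\chi(\Sigma)$, where $\chi$ is the Euler characteristic; the Euler genus of a graph $G$ is the minimum Euler genus of a closed connected surface in which $G$ embeds. A layering of $G$ is an ordered partition $(V_0,V_1,\dots,V_t)$ of $V(G)$ such that $|i-j|\le 1$ for every edge $vw\in E(G)$ with $v\in V_i$ and $w\in V_j$. A separation of $G$ is a pair $(G_1,G_2)$ of subgraphs of $G$ with $G=G_1\cup G_2$. Theorem. Let $G$ be a graph with Euler genus $g$. Then $G$ admits layered separations of width $2g+3$; that is, there is a layering $(V_0,V_1,\dots,V_t)$ of $G$ such that for every set $S\subseteq V(G)$ there is a separation $(G_1,G_2)$ of $G$ such that (i) for each $i\in\{0,1,\dots,t\}$, the layer $V_i$ contains at most $2g+3$ vertices of $V(G_1\cap G_2)$, and (ii) both $V(G_1)\setminus V(G_2)$ and $V(G_2)\setminus V(G_1)$ contain at most $\frac23|S|$ vertices of $S$. -/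

import Mathlib

/-- A cell decomposition of a closed (compact, connected, boundaryless) surface, orientable or not,
encoded by its flags. A flag is a mutually incident (vertex, edge, face) triple, that is, a triangle
of the barycentric subdivision; `a i` is the involution exchanging the two triangles that share the
side opposite to the corner of dimension `i`. So `a 0` switches to the other end of the edge,
`a 1` to the other edge at the same corner of the face, `a 2` to the other side of the edge.
Loops, parallel edges and faces of any degree are allowed. Every closed surface has such a cell
decomposition, and gluing the triangles of such a system of flags gives a closed surface. -/
structure CellSurface where
  /-- The flags. -/
  Flag : Type
  [finite : Finite Flag]
  [nonempty : Nonempty Flag]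
  /-- The three flag involutions. -/
  a : Fin 3 → Equiv.Perm Flag
  involutive : ∀ i x, a i (a i x) = x
  no_boundary : ∀ i x, a i x ≠ x
  comm : ∀ x, a 0 (a 2 x) = a 2 (a 0 x)
  edge_free : ∀ x, a 0 (a 2 x) ≠ x
  connected : ∀ x y : Flag, ∃ p ∈ Subgroup.closure (Set.range a), p x = y

namespace CellSurface

attribute [instance] CellSurface.finite CellSurface.nonempty

/-- The cells of dimension `i`: orbits of flags under the two involutions that keep the
`i`-dimensional member of a flag. -/
def Cell (M : CellSurface) (i : Fin 3) : Type :=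
  MulAction.orbitRel.Quotient (Subgroup.closure (M.a '' {j | j ≠ i})) M.Flag

/-- The cell of dimension `i` in the flag `x`. -/
def cell (M : CellSurface) (i : Fin 3) (x : M.Flag) : M.Cell i :=
  Quotient.mk _ x

/-- The Euler characteristic `#vertices - #edges + #faces` of the surface. -/
noncomputable def eulerChar (M : CellSurface) : ℤ :=
  (Nat.card (M.Cell 0) : ℤ) - Nat.card (M.Cell 1) + Nat.card (M.Cell 2)

/-- The Euler genus `2 - χ` of the surface. -/
noncomputable def eulerGenus (M : CellSurface) : ℤ :=
  2 - M.eulerChar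

end CellSurface

namespace SimpleGraph

variable {V : Type*}

/-- `G` is embedded in the surface underlying `M`, as a subgraph of the 1-skeleton of `M`:
distinct vertices of `G` are placed at distinct vertices of `M`, and each edge of `G` is drawn along
an edge of `M` (distinct edges of `G` have distinct pairs of ends, hence are drawn along distinct
edges of `M`). The 1-skeleton may have further vertices and edges, so the embedding of `G` itself
need not be cellular and `G` need not be connected. -/
def EmbedsIn (G : SimpleGraph V) (M : CellSurface) : Prop :=
  ∃ f : V → M.Cell 0, Function.Injective f ∧
    ∀ u v, G.Adj u v → ∃ x : M.Flag, M.cell 0 x = f u ∧ M.cell 0 (M.a 0 x) = f v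

/-- `G` has Euler genus `g`: the minimum Euler genus of a closed surface in which `G` embeds
is `g`. -/
def HasEulerGenus (G : SimpleGraph V) (g : ℕ) : Prop :=
  IsLeast {k : ℕ | ∃ M : CellSurface, M.eulerGenus = k ∧ G.EmbedsIn M} g

/-- A layering of `G`: an ordered partition of the vertex set into finitely many (nonempty) layers
such that the ends of each edge are in the same layer or in consecutive layers. -/
structure Layering (G : SimpleGraph V) where
  /-- The number of layers. -/
  size : ℕ
  /-- The index of the layer containing a given vertex. -/
  index : V → Fin size
  index_surjective : Function.Surjective index
  adj : ∀ u v, G.Adj u v → |((index u : ℕ) : ℤ) - ((index v : ℕ) : ℤ)| ≤ 1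

/-- The layer with index `i`. -/
def Layering.layer {G : SimpleGraph V} (L : G.Layering) (i : Fin L.size) : Set V :=
  {v | L.index v = i}

/-- A separation of `G`: a pair of subgraphs with union `G`. -/
def IsSeparation (G : SimpleGraph V) (G₁ G₂ : G.Subgraph) : Prop :=
  G₁ ⊔ G₂ = ⊤

/-- `G` admits layered separations of width `l` with respect to the layering `L`. -/
def AdmitsLayeredSeparationsWrt (G : SimpleGraph V) (L : G.Layering) (l : ℕ) : Prop :=
  ∀ S : Set V, ∃ G₁ G₂ : G.Subgraph, G.IsSeparation G₁ G₂ ∧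
    (∀ i, (L.layer i ∩ (G₁ ⊓ G₂).verts).ncard ≤ l) ∧
    (((G₁.verts \ G₂.verts) ∩ S).ncard : ℚ) ≤ 2 / 3 * (S.ncard : ℚ) ∧
    (((G₂.verts \ G₁.verts) ∩ S).ncard : ℚ) ≤ 2 / 3 * (S.ncard : ℚ)

/-- `G` admits layered separations of width `l`, with respect to some layering. -/
def AdmitsLayeredSeparations (G : SimpleGraph V) (l : ℕ) : Prop :=
  ∃ L : G.Layering, G.AdmitsLayeredSeparationsWrt L l

end SimpleGraph

/-! The barycentric subdivision of `M` is a triangulated surface whose triangles are the flags,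
whatever the degrees of the faces. Take a breadth-first spanning tree `T` of its vertices, and a
spanning tree `C` of its dual that crosses no edge of `T`. By Euler's formula at most `g` edges lie
in neither tree.

To each triangle assign the bag of all vertices on the `T`-paths to the root from its three corners
and from the ends of the extra edges. Over the tree `C` these bags form a tree decomposition
(`bag_connected`): outside the core, the triangles meeting the subtree of `T` below a vertex `w` are
joined by dual edges off `T`, and these all belong to `C`. A path to the root meets each
breadth-first level at most once, so a bag has at most `2g + 3` vertices on each level
(`ncard_bag_level_le`).

The layers of `G` are the sets of vertices at equal distance from the root vertex in the 1-skeleton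
of `M`. A tree decomposition has a bag whose removal leaves parts that can be grouped into two
sides, each with at most two thirds of `S`; that bag is the separator. -/

/-! ### Balanced separators from tree decompositions -/

/-- Choose a union of classes as large as possible subject to the bound `2s/3`. If the rest exceeded
`2s/3`, the union would have fewer than `s/3` elements. Adding a further class must overshoot, so
that class has more than `s/3` elements; being at most `s/2`, it alone is a larger admissible
choice. -/
theorem exists_balanced_grouping {V K : Type*} (T : Finset V) (c : V → K) (s : ℕ)
    (hT : T.card ≤ s) (hc : ∀ k, 2 * {v ∈ (T : Set V) | c v = k}.ncard ≤ s) :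
    ∃ Q : Set K, 3 * {v ∈ (T : Set V) | c v ∈ Q}.ncard ≤ 2 * s ∧
      3 * {v ∈ (T : Set V) | c v ∉ Q}.ncard ≤ 2 * s := by
  have hfin (P : V → Prop) : {v ∈ (T : Set V) | P v}.Finite :=
    T.finite_toSet.subset fun v hv => hv.1
  have hsum (Q : Set K) :
      {v ∈ (T : Set V) | c v ∈ Q}.ncard + {v ∈ (T : Set V) | c v ∉ Q}.ncard = T.card := by
    rw [← Set.ncard_union_eq _ (hfin _) (hfin _), ← Set.ncard_coe_finset]
    · congr 1; ext v; simp; tauto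
    · exact Set.disjoint_left.2 fun v hv hv' => hv'.2 hv.2
  let p (n : ℕ) : Prop := ∃ Q : Set K, 3 * {v ∈ (T : Set V) | c v ∈ Q}.ncard ≤ 2 * s ∧
      {v ∈ (T : Set V) | c v ∈ Q}.ncard = n
  obtain ⟨n, ⟨Q, hQ, rfl⟩, hmax⟩ : ∃ n, p n ∧ ∀ m, p m → m ≤ n := by
    classical
    refine ⟨_, Nat.findGreatest_spec (P := p) (m := 0)
      (n := T.card) (Nat.zero_le _) ⟨∅, by simp, by simp⟩, fun m hm => ?_⟩
    refine Nat.le_findGreatest ?_ hm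
    obtain ⟨Q, _, rfl⟩ := hm
    have := hsum Q
    omega
  refine ⟨Q, hQ, ?_⟩
  by_contra hlt
  have hsumQ := hsum Q
  obtain ⟨v, hv⟩ : {v ∈ (T : Set V) | c v ∉ Q}.Nonempty := by
    rw [← Set.ncard_pos (hfin _)]; omega
  have hins : {u ∈ (T : Set V) | c u ∈ insert (c v) Q}.ncard
      = {u ∈ (T : Set V) | c u ∈ Q}.ncard + {u ∈ (T : Set V) | c u = c v}.ncard := by
    rw [← Set.ncard_union_eq _ (hfin _) (hfin _)]
    · congr 1; ext u; simp; tauto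
    · exact Set.disjoint_left.2 fun u hu hu' => hv.2 (hu'.2 ▸ hu.2)
  have hpos : 0 < {u ∈ (T : Set V) | c u = c v}.ncard :=
    (Set.ncard_pos (hfin _)).2 ⟨v, hv.1, rfl⟩
  have hcv := hc (c v)
  have h1 := hmax _ ⟨{c v}, by simp only [Set.mem_singleton_iff]; omega, rfl⟩
  simp only [Set.mem_singleton_iff] at h1
  by_cases h : 3 * {u ∈ (T : Set V) | c u ∈ insert (c v) Q}.ncard ≤ 2 * s
  · have := hmax _ ⟨_, h, rfl⟩
    omega
  · omega

/-- A rooted tree, given by its parent function, with bags forming a tree decomposition of `G`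
has a bag that separates `G` in a balanced way. -/
theorem SimpleGraph.exists_separation_of_rooted_tree_decomposition {V N : Type*} [Finite V]
    [Finite N] (G : SimpleGraph V) (root : N) (π : N → N) (depth : N → ℕ)
    (hroot : π root = root) (hdepth : ∀ z, z ≠ root → depth (π z) < depth z)
    (B : N → Set V) (hne : ∀ v, ∃ z, v ∈ B z)
    (hadj : ∀ u v, G.Adj u v → ∃ z, u ∈ B z ∧ v ∈ B z)
    (hconn : ∀ v (A : Set N), (∀ z, v ∈ B z → v ∈ B (π z) → (z ∈ A ↔ π z ∈ A)) →
      ∀ z z', v ∈ B z → v ∈ B z' → z ∈ A → z' ∈ A) (S : Set V) :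
    ∃ (x : N) (G₁ G₂ : G.Subgraph), G.IsSeparation G₁ G₂ ∧ (G₁ ⊓ G₂).verts = B x ∧
      3 * ((G₁.verts \ G₂.verts) ∩ S).ncard ≤ 2 * S.ncard ∧
      3 * ((G₂.verts \ G₁.verts) ∩ S).ncard ≤ 2 * S.ncard := by
  classical
  let sub (x : N) : Set N := {z | ∃ k, π^[k] z = x}
  have hself (x) : x ∈ sub x := ⟨0, rfl⟩
  have hup {x z} (h : π z ∈ sub x) : z ∈ sub x := by
    obtain ⟨k, hk⟩ := h
    exact ⟨k + 1, by simpa using hk⟩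
  have hdown {x z} (h : z ∈ sub x) (hz : z ≠ x) : π z ∈ sub x := by
    obtain ⟨k, hk⟩ := h
    cases k with
    | zero => exact absurd hk hz
    | succ k => exact ⟨k, by simpa using hk⟩
  have hall (z) : z ∈ sub root := by
    induction hn : depth z using Nat.strong_induction_on generalizing z with
    | _ n ih =>
      by_cases hz : z = root
      · exact hz ▸ hself _
      · exact hup (ih _ (hn ▸ hdepth z hz) _ rfl)
  let Sx (x : N) : Set V := {v ∈ S | ∀ z, v ∈ B z → z ∈ sub x}
  -- A deepest node whose subtree entirely contains the bags of at least half of `S`; the root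
  -- qualifies.
  obtain ⟨x, hx, hmax⟩ : ∃ x, S.ncard ≤ 2 * (Sx x).ncard ∧
      ∀ y, S.ncard ≤ 2 * (Sx y).ncard → depth y ≤ depth x := by
    obtain ⟨x, hx⟩ := (Set.toFinite {x | S.ncard ≤ 2 * (Sx x).ncard}).exists_maximalFor depth _
      ⟨root, by
        have : Sx root = S := by ext v; simp [Sx, hall]
        simp only [Set.mem_ofPred_eq, this]; omega⟩
    refine ⟨x, hx.1, fun y hy => ?_⟩
    by_contra hlt
    exact hlt (hx.2 hy (by omega))
  -- `Quot r` is the set of components of the tree with `x` deleted.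
  let r (z z' : N) : Prop := z' = π z ∧ z ≠ x ∧ z' ≠ x
  choose nd hnd using hne
  let c (v : V) : Quot r := Quot.mk r (nd v)
  have hcl (v) (hv : v ∉ B x) (z) (hz : v ∈ B z) : Quot.mk r z = c v := by
    refine hconn v {z | Quot.mk r z = c v} (fun z hz hz' => ?_) (nd v) z (hnd v) hz rfl
    have : Quot.mk r z = Quot.mk r (π z) :=
      Quot.sound ⟨rfl, fun h => hv (h ▸ hz), fun h => hv (h ▸ hz')⟩
    simp [this]
  have hinv (A : Set N) (hA : ∀ z, z ≠ x → π z ≠ x → (z ∈ A ↔ π z ∈ A)) {z z'}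
      (h : Quot.mk r z = Quot.mk r z') : z ∈ A ↔ z' ∈ A := by
    have : Quot.lift (· ∈ A) (fun a b hab => by
      obtain ⟨rfl, h1, h2⟩ := hab
      exact propext (hA a h1 h2)) (Quot.mk r z) = (z' ∈ A) := by rw [h]
    exact Iff.of_eq this
  have hinv_sub (y) (hy : y = x ∨ π y = x) (z) (h1 : z ≠ x) (h2 : π z ≠ x) :
      z ∈ sub y ↔ π z ∈ sub y := by
    refine ⟨fun h => hdown h ?_, hup⟩
    rintro rfl
    tauto
  have hfin : (S \ B x).Finite := Set.toFinite _
  obtain ⟨Q, hQ1, hQ2⟩ := exists_balanced_grouping hfin.toFinset c S.ncard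
    (by rw [← Set.ncard_eq_toFinset_card]; exact Set.ncard_le_ncard Set.sdiff_subset)
    (by
      intro κ
      simp only [Set.Finite.coe_toFinset]
      -- A component below `x` lies in the subtree of a child `y`, which holds less than half of `S`
      -- because `x` is deepest. The component above `x` only has vertices outside `Sx x`, at most
      -- half of `S`.
      by_cases hκ : ∃ z, z ≠ x ∧ z ∈ sub x ∧ Quot.mk r z = κ
      · obtain ⟨z, hzx, hz, rfl⟩ := hκ
        obtain ⟨y, hyx, hyπ, hzy⟩ : ∃ y, y ≠ x ∧ π y = x ∧ z ∈ sub y := by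
          obtain ⟨k, hk⟩ := hz
          induction k generalizing z with
          | zero => exact absurd hk hzx
          | succ k ih =>
            by_cases h : π z = x
            · exact ⟨z, hzx, h, hself z⟩
            · obtain ⟨y, h1, h2, h3⟩ := ih (π z) h (by simpa using hk)
              exact ⟨y, h1, h2, hup h3⟩
        have hy : ¬ S.ncard ≤ 2 * (Sx y).ncard := by
          intro h
          have h1 := hmax y h
          have h2 := hdepth y (by rintro rfl; exact hyx (hroot.symm.trans hyπ))
          rw [hyπ] at h2
          omega
        have hle : {v ∈ S \ B x | c v = Quot.mk r z}.ncard ≤ (Sx y).ncard := by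
          refine Set.ncard_le_ncard ?_
          rintro v ⟨⟨hvS, hvB⟩, hvc⟩
          refine ⟨hvS, fun z' hz' => ?_⟩
          exact (hinv _ (hinv_sub y (Or.inr hyπ)) (hvc.symm.trans (hcl v hvB z' hz').symm)).1 hzy
        omega
      · have hle : {v ∈ S \ B x | c v = κ}.ncard ≤ (S \ Sx x).ncard := by
          refine Set.ncard_le_ncard ?_
          rintro v ⟨⟨hvS, hvB⟩, hvc⟩
          refine ⟨hvS, fun h => hκ ⟨nd v, ?_, h.2 _ (hnd v), hvc⟩⟩
          intro h; exact hvB (h ▸ hnd v)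
        have := Set.ncard_sdiff_add_ncard_of_subset (s := Sx x) (t := S) (fun v hv => hv.1)
        omega)
  simp only [Set.Finite.coe_toFinset] at hQ1 hQ2
  let P₁ : Set V := {v | v ∈ B x ∨ c v ∈ Q}
  let P₂ : Set V := {v | v ∈ B x ∨ c v ∉ Q}
  refine ⟨x, (⊤ : G.Subgraph).induce P₁, (⊤ : G.Subgraph).induce P₂, ?_, ?_, ?_, ?_⟩
  · refine le_antisymm le_top ⟨fun v _ => ?_, fun u v huv => ?_⟩
    · by_cases h : c v ∈ Q
      · exact Or.inl (Or.inr h)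
      · exact Or.inr (Or.inr h)
    · have huv' : G.Adj u v := huv
      obtain ⟨z, hu, hv⟩ := hadj u v huv'
      have hcuv : u ∉ B x → v ∉ B x → c u = c v := fun h1 h2 =>
        (hcl u h1 z hu).symm.trans (hcl v h2 z hv)
      simp only [SimpleGraph.Subgraph.sup_adj, SimpleGraph.Subgraph.induce_adj,
        SimpleGraph.Subgraph.top_adj, P₁, P₂, Set.mem_ofPred_eq, huv', and_true]
      by_cases h1 : u ∈ B x <;> by_cases h2 : v ∈ B x
      · simp [h1, h2]
      · simp [h1, h2, em]
      · simp [h1, h2, em]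
      · simp [h1, h2, hcuv h1 h2, em]
  · ext v
    simp only [SimpleGraph.Subgraph.verts_inf, SimpleGraph.Subgraph.induce_verts, P₁, P₂]
    simp only [Set.mem_inter_iff, Set.mem_ofPred_eq]
    tauto
  · refine le_trans (Nat.mul_le_mul_left 3 (Set.ncard_le_ncard ?_)) hQ1
    rintro v ⟨⟨h1, h2⟩, hS⟩
    simp only [SimpleGraph.Subgraph.induce_verts, P₁, P₂, Set.mem_ofPred_eq] at h1 h2
    exact ⟨⟨hS, by tauto⟩, by tauto⟩
  · refine le_trans (Nat.mul_le_mul_left 3 (Set.ncard_le_ncard ?_)) hQ2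
    rintro v ⟨⟨h1, h2⟩, hS⟩
    simp only [SimpleGraph.Subgraph.induce_verts, P₁, P₂, Set.mem_ofPred_eq] at h1 h2
    exact ⟨⟨hS, by tauto⟩, by tauto⟩

/-! ### Layerings, breadth-first distance and parity -/

/-- The values of `d` may have gaps, since distances are measured in a larger graph, while layers
must be nonempty. Renumbering the attained values in increasing order closes the gaps: indices
differing by two or more have an attained value strictly between, so the distances also differ by at
least two. -/
theorem SimpleGraph.exists_layering_of_dist {V : Type*} [Finite V] (G : SimpleGraph V) (d : V → ℕ)
    (hd : ∀ u v, G.Adj u v → d u ≤ d v + 1) :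
    ∃ L : G.Layering, ∀ u v, L.index u = L.index v → d u = d v := by
  classical
  have := Fintype.ofFinite V
  let D := Finset.univ.image d
  let e := D.orderIsoOfFin rfl
  let idx (v : V) : Fin D.card := e.symm ⟨d v, Finset.mem_image_of_mem _ (Finset.mem_univ _)⟩
  have hlt (u v) : idx u < idx v ↔ d u < d v := by simp [idx]
  have key (u v) (h : d u ≤ d v + 1) : (idx u : ℕ) ≤ idx v + 1 := by
    by_contra hcon
    obtain ⟨w, hw⟩ : ∃ w, idx w = ⟨idx v + 1, by omega⟩ := by
      have hmem := (e ⟨idx v + 1, by omega⟩).2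
      obtain ⟨w, -, hw⟩ := Finset.mem_image.1 hmem
      exact ⟨w, by simp [idx, hw]⟩
    have h1 := (hlt v w).1 (by rw [hw, Fin.lt_def]; simp)
    have h2 := (hlt w u).1 (by rw [hw, Fin.lt_def]; simpa using hcon)
    omega
  refine ⟨⟨D.card, idx, fun k => ?_, fun u v huv => ?_⟩, fun u v h => ?_⟩
  · obtain ⟨w, -, hw⟩ := Finset.mem_image.1 (e k).2
    exact ⟨w, by simp [idx, hw]⟩
  · have h1 := key u v (hd u v huv)
    have h2 := key v u (hd v u huv.symm)
    rw [abs_le]; omega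
  · have h' : idx u = idx v := h
    have h1 := hlt u v
    have h2 := hlt v u
    rw [h'] at h1 h2
    simp only [lt_irrefl, false_iff, not_lt] at h1 h2
    omega

theorem exists_bfs_distance {α : Type*} (r : α → α → Prop) (ρ : α)
    (hconn : ∀ A : Set α, ρ ∈ A → (∀ x y, r x y → x ∈ A → y ∈ A) → ∀ x, x ∈ A) :
    ∃ d : α → ℕ, (∀ y, y ≠ ρ → ∃ x, r x y ∧ d y = d x + 1) ∧
      ∀ x y, r x y → d y ≤ d x + 1 := by
  classical
  -- The points reached by a walk of exactly `n` steps; the distance is the least such `n`.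
  let S (n : ℕ) : Set α := Nat.rec (motive := fun _ => Set α) {ρ} (fun _ s => {y | ∃ x ∈ s, r x y}) n
  have hS : ∀ x, ∃ n, x ∈ S n := by
    refine hconn {x | ∃ n, x ∈ S n} ⟨0, rfl⟩ ?_
    rintro x y hxy ⟨n, hn⟩
    exact ⟨n + 1, x, hn, hxy⟩
  have hle (x y) (hxy : r x y) : Nat.find (hS y) ≤ Nat.find (hS x) + 1 :=
    Nat.find_min' _ ⟨x, Nat.find_spec (hS x), hxy⟩
  refine ⟨fun x => Nat.find (hS x), fun y hy => ?_, hle⟩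
  have hspec := Nat.find_spec (hS y)
  cases hn : Nat.find (hS y) with
  | zero => rw [hn] at hspec; exact absurd hspec hy
  | succ n =>
    rw [hn] at hspec
    obtain ⟨x, hx, hxy⟩ := hspec
    refine ⟨x, hxy, ?_⟩
    have h1 := hle x y hxy
    have h2 := Nat.find_min' (hS x) hx
    simp only [hn] at h1 ⊢
    omega

theorem Finset.even_card_of_involution {α : Type*} (s : Finset α) (σ : α → α)
    (hmem : ∀ x ∈ s, σ x ∈ s) (hne : ∀ x, σ x ≠ x) (hinv : ∀ x, σ (σ x) = x) :
    Even s.card := by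
  have h : ∑ _x ∈ s, (1 : ZMod 2) = 0 :=
    Finset.sum_involution (fun x _ => σ x) (fun _ _ => by decide) (fun x _ _ => hne x)
      (fun x hx => hmem x hx) (fun x _ => hinv x)
  rw [Finset.sum_const, nsmul_one, ZMod.natCast_eq_zero_iff] at h
  exact even_iff_two_dvd.2 h

/-! ### Flags, cells and the barycentric subdivision -/

namespace CellSurface

variable (M : CellSurface)

theorem mem_of_mem_closure {J : Set (Fin 3)} {A : Set M.Flag}
    (hA : ∀ j ∈ J, ∀ x ∈ A, M.a j x ∈ A) {p : Equiv.Perm M.Flag}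
    (hp : p ∈ Subgroup.closure (M.a '' J)) : ∀ x ∈ A, p x ∈ A := by
  induction hp using Subgroup.closure_induction'' with
  | mem p hp => obtain ⟨j, hj, rfl⟩ := hp; exact hA j hj
  | inv_mem p hp =>
    obtain ⟨j, hj, rfl⟩ := hp
    intro x hx
    have : (M.a j)⁻¹ x = M.a j x := by rw [Equiv.Perm.inv_eq_iff_eq, M.involutive]
    exact this ▸ hA j hj x hx
  | one => exact fun x hx => hx
  | mul p q _ _ hp hq => exact fun x hx => hp _ (hq _ hx)

theorem mem_of_mem {A : Set M.Flag} (hA : ∀ j, ∀ x ∈ A, M.a j x ∈ A) {x : M.Flag}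
    (hx : x ∈ A) (y : M.Flag) : y ∈ A := by
  obtain ⟨p, hp, rfl⟩ := M.connected x y
  rw [← Set.image_univ] at hp
  exact M.mem_of_mem_closure (fun j _ => hA j) hp x hx

theorem mem_of_cell_eq {i : Fin 3} {A : Set M.Flag} (hA : ∀ j, j ≠ i → ∀ x ∈ A, M.a j x ∈ A)
    {x y : M.Flag} (h : M.cell i x = M.cell i y) (hx : x ∈ A) : y ∈ A := by
  obtain ⟨⟨p, hp⟩, rfl⟩ := Quotient.exact h.symm
  exact M.mem_of_mem_closure hA hp x hx

theorem cell_a {i j : Fin 3} (h : i ≠ j) (x : M.Flag) : M.cell i (M.a j x) = M.cell i x :=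
  Quotient.sound ⟨⟨M.a j, Subgroup.subset_closure ⟨j, h.symm, rfl⟩⟩, rfl⟩

theorem exists_cell_eq {i : Fin 3} (c : M.Cell i) : ∃ x, M.cell i x = c :=
  Quotient.exists_rep c

instance (i : Fin 3) : Finite (M.Cell i) := Finite.of_surjective (M.cell i) M.exists_cell_eq

theorem eq_of_cell_one_eq {x y : M.Flag} (h : M.cell 1 x = M.cell 1 y) :
    y = x ∨ y = M.a 0 x ∨ y = M.a 2 x ∨ y = M.a 0 (M.a 2 x) := by
  refine M.mem_of_cell_eq
    (A := {y | y = x ∨ y = M.a 0 x ∨ y = M.a 2 x ∨ y = M.a 0 (M.a 2 x)}) ?_ h (Or.inl rfl)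
  intro j hj y hy
  have hj' : j = 0 ∨ j = 2 := by revert hj; revert j; decide
  rcases hj' with rfl | rfl <;> rcases hy with rfl | rfl | rfl | rfl <;>
    simp [M.involutive, ← M.comm]

theorem card_flag_le : Nat.card M.Flag ≤ 4 * Nat.card (M.Cell 1) := by
  classical
  have := Fintype.ofFinite M.Flag
  have := Fintype.ofFinite (M.Cell 1)
  rw [Nat.card_eq_fintype_card, Nat.card_eq_fintype_card, ← Finset.card_univ, ← Finset.card_univ]
  refine Finset.card_le_mul_card_image_of_maps_to (f := M.cell 1) (fun _ _ => Finset.mem_univ _) 4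
    fun c _ => ?_
  obtain ⟨x, rfl⟩ := M.exists_cell_eq c
  refine (Finset.card_le_card (t := {x, M.a 0 x, M.a 2 x, M.a 0 (M.a 2 x)}) ?_).trans
    Finset.card_le_four
  intro y hy
  have := M.eq_of_cell_one_eq (Finset.mem_filter.1 hy).2.symm
  simpa using this

/-- The cells of all dimensions, that is, the vertices of the barycentric subdivision. -/
abbrev AllCells : Type := Σ i, M.Cell i

/-- The cell of dimension `i` in the flag `x`, as a vertex of the barycentric subdivision. -/
def vert (i : Fin 3) (x : M.Flag) : M.AllCells := ⟨i, M.cell i x⟩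

theorem vert_a {i j : Fin 3} (h : i ≠ j) (x : M.Flag) : M.vert i (M.a j x) = M.vert i x := by
  simp [vert, M.cell_a h]

theorem exists_vert_eq (w : M.AllCells) : ∃ x, M.vert w.1 x = w := by
  obtain ⟨x, hx⟩ := M.exists_cell_eq w.2
  exact ⟨x, by simp [vert, hx]⟩

theorem cell_eq_of_vert_eq {i : Fin 3} {x y : M.Flag} (h : M.vert i x = M.vert i y) :
    M.cell i x = M.cell i y := by
  simpa [vert] using h

/-- A rooted spanning tree of the barycentric subdivision. The side opposite to the corner of
dimension `dim w` in the triangle `flag w` is the edge that joins `w` to its parent. -/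
structure RootedTree where
  /-- The root. -/
  root : M.AllCells
  /-- The parent of a vertex. -/
  par : M.AllCells → M.AllCells
  /-- A function that decreases towards the root. -/
  rank : M.AllCells → ℕ
  /-- A triangle at the edge to the parent. -/
  flag : M.AllCells → M.Flag
  /-- The dimension of the third corner of that triangle. -/
  dim : M.AllCells → Fin 3
  par_root : par root = root
  rank_par : ∀ w, w ≠ root → rank (par w) < rank w
  dim_ne : ∀ w, w ≠ root → dim w ≠ w.1
  vert_flag : ∀ w, w ≠ root → M.vert w.1 (flag w) = w
  vert_flag_eq_par : ∀ w, w ≠ root → ∀ j, j ≠ w.1 → j ≠ dim w → M.vert j (flag w) = par w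

/-! ### Paths to the root, and dual connectivity around a subtree -/

namespace RootedTree

variable {M} (T : M.RootedTree)

/-- The sides `(x, i)` of triangles that are edges of the tree. -/
def sides : Set (M.Flag × Fin 3) :=
  {e | ∃ w, w ≠ T.root ∧ (e = (T.flag w, T.dim w) ∨ e = (M.a (T.dim w) (T.flag w), T.dim w))}

/-- `w` lies on the path of the tree from `u` to the root. -/
def Above (u w : M.AllCells) : Prop := ∃ n, T.par^[n] u = w

theorem above_refl (u : M.AllCells) : T.Above u u := ⟨0, rfl⟩

theorem above_par (u : M.AllCells) : T.Above u (T.par u) := ⟨1, rfl⟩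

variable {T} in
theorem Above.trans {u v w : M.AllCells} (h : T.Above u v) (h' : T.Above v w) : T.Above u w := by
  obtain ⟨n, rfl⟩ := h
  obtain ⟨m, rfl⟩ := h'
  exact ⟨m + n, Function.iterate_add_apply _ _ _ _⟩

theorem above_root (u : M.AllCells) : T.Above u T.root := by
  induction hn : T.rank u using Nat.strong_induction_on generalizing u with
  | _ n ih =>
    by_cases hu : u = T.root
    · exact hu ▸ T.above_refl _
    · exact (T.above_par u).trans (ih _ (hn ▸ T.rank_par u hu) _ rfl)

theorem eq_or_rank_lt {u w : M.AllCells} (h : T.Above u w) : u = w ∨ T.rank w < T.rank u := by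
  obtain ⟨n, hn⟩ := h
  induction n generalizing u with
  | zero => exact Or.inl hn
  | succ n ih =>
    by_cases hu : u = T.root
    · exact ih (by rw [← hn, Function.iterate_succ_apply, hu, T.par_root])
    · have := T.rank_par u hu
      rcases ih (by simpa using hn) with h | h
      · exact Or.inr (h ▸ this)
      · exact Or.inr (h.trans this)

/-- The rank falls strictly along a path to the root, so a path meets each level at most once. This
is the source of the width bound. -/
theorem eq_of_above_of_rank_eq {u w w' : M.AllCells} (h : T.Above u w) (h' : T.Above u w')
    (hr : T.rank w = T.rank w') : w = w' := by
  obtain ⟨n, rfl⟩ := h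
  obtain ⟨m, rfl⟩ := h'
  wlog hnm : n ≤ m generalizing n m
  · exact (this m n hr.symm (by omega)).symm
  obtain ⟨k, rfl⟩ := Nat.exists_eq_add_of_le' hnm
  rcases T.eq_or_rank_lt (u := T.par^[n] u) ⟨k, (Function.iterate_add_apply _ _ _ _).symm⟩ with h | h
  · exact h
  · omega

theorem exists_of_mem_sides {x : M.Flag} {i : Fin 3} (h : (x, i) ∈ T.sides) :
    ∃ w, w ≠ T.root ∧ T.dim w = i ∧ (x = T.flag w ∨ x = M.a i (T.flag w)) ∧
      ∀ j, j ≠ i → M.vert j x = w ∨ M.vert j x = T.par w := by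
  obtain ⟨w, hw, h⟩ := h
  have hi : T.dim w = i := by
    rcases h with h | h <;> exact (Prod.ext_iff.1 h).2.symm
  subst hi
  have hx : x = T.flag w ∨ x = M.a (T.dim w) (T.flag w) :=
    h.imp (fun h => (Prod.ext_iff.1 h).1) (fun h => (Prod.ext_iff.1 h).1)
  refine ⟨w, hw, rfl, hx, fun j hj => ?_⟩
  have hv : M.vert j x = M.vert j (T.flag w) := by
    rcases hx with rfl | rfl
    · rfl
    · exact M.vert_a hj _
  rw [hv]
  by_cases hjw : j = w.1
  · exact Or.inl (hjw ▸ T.vert_flag w hw)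
  · exact Or.inr (T.vert_flag_eq_par w hw j hjw hj)

theorem a_mem_sides {x : M.Flag} {i : Fin 3} (h : (x, i) ∈ T.sides) : (M.a i x, i) ∈ T.sides := by
  obtain ⟨w, hw, rfl, rfl | rfl, -⟩ := T.exists_of_mem_sides h
  · exact ⟨w, hw, Or.inr rfl⟩
  · exact ⟨w, hw, Or.inl (by rw [M.involutive])⟩

/-- If a set of triangles is not separated by non-tree edges at the descendants of `w`, then
neither is it by tree edges there: its boundary would have a deepest edge, while every vertex
meets its boundary an even number of times. -/
theorem flag_mem_iff_of_above {w : M.AllCells} {A : Set M.Flag}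
    (h : ∀ x i j, j ≠ i → T.Above (M.vert j x) w → (x, i) ∉ T.sides → (x ∈ A ↔ M.a i x ∈ A))
    {u : M.AllCells} (hu : u ≠ T.root) (huw : T.Above u w) :
    T.flag u ∈ A ↔ M.a (T.dim u) (T.flag u) ∈ A := by
  classical
  by_contra hcon
  obtain ⟨u, ⟨hu, huw, hcon⟩, hmax⟩ := (Set.toFinite {u | u ≠ T.root ∧ T.Above u w ∧
    ¬ (T.flag u ∈ A ↔ M.a (T.dim u) (T.flag u) ∈ A)}).exists_maximalFor T.rank _ ⟨u, hu, huw, hcon⟩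
  have hchild (u') (hu' : u' ≠ T.root) (hpar : T.par u' = u) :
      T.flag u' ∈ A ↔ M.a (T.dim u') (T.flag u') ∈ A := by
    by_contra hc
    have hlt := T.rank_par u' hu'
    have := hmax (j := u') ⟨hu', ((T.above_par u').trans (hpar ▸ huw)), hc⟩ (by
      rw [hpar] at hlt; exact hlt.le)
    rw [hpar] at hlt
    omega
  obtain ⟨y, hyu, hyA, hyA', hyf⟩ : ∃ y, M.vert u.1 y = u ∧ y ∈ A ∧ M.a (T.dim u) y ∉ A ∧
      ∀ x, x = T.flag u ∨ x = M.a (T.dim u) (T.flag u) → x = y ∨ x = M.a (T.dim u) y := by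
    by_cases hf : T.flag u ∈ A
    · exact ⟨T.flag u, T.vert_flag u hu, hf, by tauto, fun x hx => hx⟩
    · refine ⟨M.a (T.dim u) (T.flag u), ?_, by tauto, by rwa [M.involutive], fun x hx => ?_⟩
      · rw [M.vert_a (T.dim_ne u hu).symm, T.vert_flag u hu]
      · rw [M.involutive]; exact hx.symm
  -- Around `u`, only a tree edge can leave `A`. Edges to children are excluded by the maximal rank
  -- of `u`, so the sole exit is through the parent edge, from `y`.
  have hcross (x i) (hi : i ≠ u.1) (hx : M.vert u.1 x = u) (hxA : x ∈ A) (hxA' : M.a i x ∉ A) :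
      i = T.dim u ∧ x = y := by
    have hT : (x, i) ∈ T.sides := by
      by_contra hT
      exact hxA' ((h x i u.1 hi.symm (hx.symm ▸ huw) hT).1 hxA)
    obtain ⟨w', hw', rfl, hxw, hend⟩ := T.exists_of_mem_sides hT
    rcases hend u.1 hi.symm with h1 | h1 <;> rw [hx] at h1
    · subst h1
      refine ⟨rfl, (hyf x hxw).resolve_right ?_⟩
      rintro rfl
      exact hyA' hxA
    · have := hchild w' hw' h1.symm
      rcases hxw with rfl | rfl
      · tauto
      · rw [M.involutive] at hxA'; tauto
  obtain ⟨k, hk, hk'⟩ : ∃ k, k ≠ u.1 ∧ k ≠ T.dim u := by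
    generalize u.1 = p, T.dim u = q
    revert p q; decide
  have := Fintype.ofFinite M.Flag
  let s : Finset M.Flag := Finset.univ.filter fun x => M.vert u.1 x = u ∧ x ∈ A
  have hs (x) : x ∈ s ↔ M.vert u.1 x = u ∧ x ∈ A := by simp [s]
  -- Of the two involutions around `u`, `a k` preserves the triangles of `A` at `u`, whereas `a (dim
  -- u)` preserves them only after `y` is removed. Both sets would then have even size.
  have h1 : Even s.card := by
    refine s.even_card_of_involution (M.a k) (fun x hx => ?_) (M.no_boundary k) (M.involutive k)
    rw [hs] at hx ⊢
    refine ⟨by rw [M.vert_a hk.symm, hx.1], ?_⟩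
    by_contra hc
    exact hk' (hcross x k hk hx.1 hx.2 hc).1
  have h2 : Even (s.erase y).card := by
    refine (s.erase y).even_card_of_involution (M.a (T.dim u)) (fun x hx => ?_)
      (M.no_boundary _) (M.involutive _)
    rw [Finset.mem_erase, hs] at hx ⊢
    refine ⟨?_, by rw [M.vert_a (T.dim_ne u hu).symm, hx.2.1], ?_⟩
    · rintro rfl
      rw [M.involutive] at hyA'
      exact hyA' hx.2.2
    · by_contra hc
      exact hx.1 (hcross x _ (T.dim_ne u hu) hx.2.1 hx.2.2 hc).2
  have hys : y ∈ s := (hs y).2 ⟨hyu, hyA⟩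
  have := Finset.card_erase_add_one hys
  rw [← this, Nat.even_add_one] at h1
  exact h1 h2

/-- Triangles with a corner in the subtree below `w` are connected through non-tree sides with an
end in that subtree. Once tree sides do not separate `A` there either, one may rotate freely about
each vertex and climb the tree to `w`, where all triangles are compared. -/
theorem mem_of_above {w : M.AllCells} {A : Set M.Flag}
    (h : ∀ x i j, j ≠ i → T.Above (M.vert j x) w → (x, i) ∉ T.sides → (x ∈ A ↔ M.a i x ∈ A))
    {x y : M.Flag} {j k : Fin 3} (hx : T.Above (M.vert j x) w) (hy : T.Above (M.vert k y) w)
    (hxA : x ∈ A) : y ∈ A := by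
  have hside (x i j) (hji : j ≠ i) (hw : T.Above (M.vert j x) w) : x ∈ A ↔ M.a i x ∈ A := by
    by_cases hT : (x, i) ∈ T.sides
    · obtain ⟨u, hu, rfl, hxu, hend⟩ := T.exists_of_mem_sides hT
      have huw : T.Above u w := by
        rcases hend j hji with h1 | h1
        · exact h1 ▸ hw
        · exact (T.above_par u).trans (h1 ▸ hw)
      have := T.flag_mem_iff_of_above h hu huw
      rcases hxu with rfl | rfl
      · exact this
      · rw [M.involutive]; exact this.symm
    · exact h x i j hji hw hT
  have hvert (x y j) (hw : T.Above (M.vert j x) w) (hxy : M.vert j x = M.vert j y) (hxA : x ∈ A) :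
      y ∈ A := by
    refine (M.mem_of_cell_eq (A := {z | M.vert j z = M.vert j x ∧ z ∈ A}) ?_
      (M.cell_eq_of_vert_eq hxy) ⟨rfl, hxA⟩).2
    rintro i hij z ⟨hz, hzA⟩
    exact ⟨by rw [M.vert_a hij.symm, hz], (hside z i j hij.symm (hz ▸ hw)).1 hzA⟩
  have hpath (n : ℕ) (u) (hn : T.par^[n] u = w) (x y) (hxu : M.vert u.1 x = u)
      (hyw : M.vert w.1 y = w) : x ∈ A ↔ y ∈ A := by
    induction n generalizing u x with
    | zero =>
      obtain rfl : u = w := hn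
      exact ⟨hvert x y _ (hxu.symm ▸ T.above_refl _) (hxu.trans hyw.symm),
        hvert y x _ (hyw.symm ▸ T.above_refl _) (hyw.trans hxu.symm)⟩
    | succ n ih =>
      by_cases hu : u = T.root
      · refine ih u ?_ x hxu
        rw [← hn, Function.iterate_succ_apply, hu, T.par_root]
      · have huw : T.Above u w := ⟨_, hn⟩
        obtain ⟨k, hk, hk'⟩ : ∃ k, k ≠ u.1 ∧ k ≠ T.dim u := by
          generalize u.1 = p, T.dim u = q
          revert p q; decide
        have h1 := T.vert_flag_eq_par u hu k hk hk'
        have h2 := ih (T.par u) (by simpa using hn) (T.flag u) (by rw [← h1]; rfl)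
        have h3 := T.vert_flag u hu
        exact ⟨fun hxA => h2.1 (hvert x _ _ (hxu.symm ▸ huw) (hxu.trans h3.symm) hxA),
          fun hyA => hvert _ x _ (h3.symm ▸ huw) (h3.trans hxu.symm) (h2.2 hyA)⟩
  obtain ⟨z, hz⟩ := M.exists_vert_eq w
  obtain ⟨n, hn⟩ := hx
  obtain ⟨m, hm⟩ := hy
  exact (hpath m _ hm y z rfl hz).2 ((hpath n _ hn x z rfl hz).1 hxA)

end RootedTree

end CellSurface

/-- A union of two-element orbits of an involution, indexed by the elements other than `r`, has
`2 * (card - 1)` elements. -/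
theorem ncard_paired_range {α β : Type*} [Finite α] [Finite β] (r : α) (q : α → β) (σ : β → β)
    (hσ : ∀ b, σ (σ b) = b) (hne : ∀ b, σ b ≠ b)
    (hq : ∀ w w', w ≠ r → w' ≠ r → (q w = q w' ∨ q w = σ (q w')) → w = w') :
    {e | ∃ w, w ≠ r ∧ (e = q w ∨ e = σ (q w))}.ncard + 2 = 2 * Nat.card α := by
  have hinj : Set.InjOn q {r}ᶜ := fun w hw w' hw' h => hq w w' hw hw' (Or.inl h)
  have hset : {e | ∃ w, w ≠ r ∧ (e = q w ∨ e = σ (q w))} = q '' {r}ᶜ ∪ σ '' (q '' {r}ᶜ) := by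
    ext e
    simp only [Set.mem_ofPred_eq, Set.mem_union, Set.mem_image, Set.mem_compl_iff,
      Set.mem_singleton_iff]
    constructor
    · rintro ⟨w, hw, rfl | rfl⟩
      · exact Or.inl ⟨w, hw, rfl⟩
      · exact Or.inr ⟨_, ⟨w, hw, rfl⟩, rfl⟩
    · rintro (⟨w, hw, rfl⟩ | ⟨_, ⟨w, hw, rfl⟩, rfl⟩)
      · exact ⟨w, hw, Or.inl rfl⟩
      · exact ⟨w, hw, Or.inr rfl⟩
  have hdisj : Disjoint (q '' {r}ᶜ) (σ '' (q '' {r}ᶜ)) := by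
    rw [Set.disjoint_left]
    rintro _ ⟨w, hw, rfl⟩ ⟨_, ⟨w', hw', rfl⟩, h⟩
    obtain rfl := hq w w' hw hw' (Or.inr h.symm)
    exact hne _ h
  have hσinj : Function.Injective σ := Function.LeftInverse.injective hσ
  rw [hset, Set.ncard_union_eq hdisj, Set.ncard_image_of_injective _ hσinj,
    hinj.ncard_image]
  have := Set.ncard_add_ncard_compl ({r} : Set α)
  rw [Set.ncard_singleton] at this
  omega

/-! ### Tree, cotree and Euler's formula -/

namespace CellSurface

variable {M : CellSurface}

theorem card_allCells (M : CellSurface) :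
    Nat.card M.AllCells = Nat.card (M.Cell 0) + Nat.card (M.Cell 1) + Nat.card (M.Cell 2) := by
  rw [Nat.card_sigma, Fin.sum_univ_three]

namespace RootedTree

variable (T : M.RootedTree)

theorem ncard_sides : T.sides.ncard + 2 = 2 * Nat.card M.AllCells := by
  refine ncard_paired_range T.root (fun w => (T.flag w, T.dim w)) (fun e => (M.a e.2 e.1, e.2))
    (fun e => by simp [M.involutive]) (fun e h => M.no_boundary _ _ (Prod.ext_iff.1 h).1) ?_
  have key (w w') (hw : w ≠ T.root)
      (h : (T.flag w, T.dim w) = (T.flag w', T.dim w') ∨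
        (T.flag w, T.dim w) = (M.a (T.dim w') (T.flag w'), T.dim w')) (hw' : w' ≠ T.root) :
      w = w' ∨ w = T.par w' := by
    have hd : T.dim w = T.dim w' := by
      rcases h with h | h <;> exact (Prod.ext_iff.1 h).2
    have hv : M.vert w.1 (T.flag w) = M.vert w.1 (T.flag w') := by
      rcases h with h | h
      · rw [show T.flag w = T.flag w' from (Prod.ext_iff.1 h).1]
      · rw [show T.flag w = M.a (T.dim w') (T.flag w') from (Prod.ext_iff.1 h).1]
        exact M.vert_a (by rw [← hd]; exact (T.dim_ne w hw).symm) _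
    rw [T.vert_flag w hw] at hv
    by_cases hww : w.1 = w'.1
    · left; rw [hv, hww, T.vert_flag w' hw']
    · right; rw [hv]
      exact T.vert_flag_eq_par w' hw' _ hww (by rw [← hd]; exact (T.dim_ne w hw).symm)
  intro w w' hw hw' h
  have h' : (T.flag w', T.dim w') = (T.flag w, T.dim w) ∨
      (T.flag w', T.dim w') = (M.a (T.dim w) (T.flag w), T.dim w) := by
    rcases h with h | h
    · exact Or.inl h.symm
    · have h1 := (Prod.ext_iff.1 h).1
      have h2 := (Prod.ext_iff.1 h).2
      simp only at h1 h2
      refine Or.inr (Prod.ext ?_ h2.symm)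
      simp only
      rw [h1, h2, M.involutive]
  -- Distinct vertices with the same parent edge would be parents of each other, contrary to the
  -- rank.
  rcases key w w' hw h hw' with h1 | h1
  · exact h1
  · rcases key w' w hw' h' hw with h2 | h2
    · exact h2.symm
    · have h3 := T.rank_par w hw
      have h4 := T.rank_par w' hw'
      rw [← h2] at h3
      rw [← h1] at h4
      omega

end RootedTree

/-- A rooted spanning tree of the dual of the barycentric subdivision that crosses no edge of `T`;
`side z` is the third corner of the side of `z` that its edge to its parent crosses. -/
structure RootedCotree (T : M.RootedTree) where
  /-- The root. -/
  root : M.Flag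
  /-- The parent of a triangle. -/
  par : M.Flag → M.Flag
  /-- The side of a triangle towards its parent. -/
  side : M.Flag → Fin 3
  /-- A function that decreases towards the root. -/
  depth : M.Flag → ℕ
  par_root : par root = root
  depth_par : ∀ z, z ≠ root → depth (par z) < depth z
  par_eq : ∀ z, z ≠ root → par z = M.a (side z) z
  notMem_sides : ∀ z, z ≠ root → (z, side z) ∉ T.sides

namespace RootedCotree

/-- Cutting the surface along a tree does not disconnect it: this is `mem_of_above` at the root. A
breadth-first search over non-tree sides then gives the cotree. -/
theorem nonempty (T : M.RootedTree) : Nonempty (RootedCotree T) := by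
  obtain ⟨ρ⟩ := M.nonempty
  obtain ⟨d, hd, -⟩ := exists_bfs_distance
    (fun x y => ∃ i, (x, i) ∉ T.sides ∧ y = M.a i x) ρ (fun A hρ hA y => by
      refine T.mem_of_above (w := T.root) (A := A) (x := ρ) (j := 0) (k := 0) ?_
        (T.above_root _) (T.above_root _) hρ
      intro x i j _ _ hT
      refine ⟨fun h => hA x _ ⟨i, hT, rfl⟩ h, fun h => hA _ x ⟨i, ?_, ?_⟩ h⟩
      · intro hT'
        have := T.a_mem_sides hT'
        rw [M.involutive] at this
        exact hT this
      · rw [M.involutive])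
  have h (y : M.Flag) : ∃ p : M.Flag × Fin 3, (y = ρ → p.1 = ρ) ∧
      (y ≠ ρ → d p.1 < d y ∧ p.1 = M.a p.2 y ∧ (y, p.2) ∉ T.sides) := by
    by_cases hy : y = ρ
    · exact ⟨(ρ, 0), fun _ => rfl, fun h => absurd hy h⟩
    · obtain ⟨x, ⟨i, hT, rfl⟩, hdx⟩ := hd y hy
      refine ⟨(x, i), fun h => absurd h hy, fun _ => ⟨by simp only; omega, ?_, ?_⟩⟩
      · simp [M.involutive]
      · intro hT'
        have := T.a_mem_sides hT'
        rw [M.involutive] at this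
        exact hT this
  choose p hp hp' using h
  exact ⟨⟨ρ, fun y => (p y).1, fun y => (p y).2, d, hp ρ rfl, fun z hz => (hp' z hz).1,
    fun z hz => (hp' z hz).2.1, fun z hz => (hp' z hz).2.2⟩⟩

variable {T : M.RootedTree} (C : RootedCotree T)

/-- The sides of triangles that are crossed by the cotree. -/
def sides : Set (M.Flag × Fin 3) :=
  {e | ∃ z, z ≠ C.root ∧ (e = (z, C.side z) ∨ e = (M.a (C.side z) z, C.side z))}

theorem ncard_sides : C.sides.ncard + 2 = 2 * Nat.card M.Flag := by
  refine ncard_paired_range C.root (fun z => (z, C.side z)) (fun e => (M.a e.2 e.1, e.2))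
    (fun e => by simp [M.involutive]) (fun e h => M.no_boundary _ _ (Prod.ext_iff.1 h).1) ?_
  rintro z z' hz hz' (h | h)
  · exact (Prod.ext_iff.1 h).1
  · have h1 : z = M.a (C.side z') z' := (Prod.ext_iff.1 h).1
    have h2 : C.side z = C.side z' := (Prod.ext_iff.1 h).2
    have h3 := C.depth_par z hz
    have h4 := C.depth_par z' hz'
    rw [C.par_eq z' hz', ← h1] at h4
    rw [C.par_eq z hz, h2, h1, M.involutive, ← h1] at h3
    omega

/-- The sides of triangles that belong neither to the tree nor to the cotree. -/
def extra : Set (M.Flag × Fin 3) := {e | e ∉ T.sides ∧ e ∉ C.sides}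

theorem a_mem_sides {x : M.Flag} {i : Fin 3} (h : (x, i) ∈ C.sides) : (M.a i x, i) ∈ C.sides := by
  obtain ⟨z, hz, h | h⟩ := h <;> rw [Prod.mk.injEq] at h <;> obtain ⟨rfl, rfl⟩ := h
  · exact ⟨_, hz, Or.inr rfl⟩
  · exact ⟨z, hz, Or.inl (by simp [M.involutive])⟩

theorem a_mem_extra {x : M.Flag} {i : Fin 3} (h : (x, i) ∈ C.extra) :
    (M.a i x, i) ∈ C.extra := by
  refine ⟨fun h' => h.1 ?_, fun h' => h.2 ?_⟩
  · simpa [M.involutive] using T.a_mem_sides h'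
  · simpa [M.involutive] using C.a_mem_sides h'

/-- With `F` flags and `N` cells in all, there are `3F` sides, of which the tree uses `2N - 2` and
the cotree `2F - 2`. The remainder `F - 2N + 4` is at most twice the Euler genus, since `F` is at
most four times the number of edges of `M`. The factor two is there because each edge of the
triangulation is two sides. -/
theorem ncard_extra_le : (C.extra.ncard : ℤ) ≤ 2 * M.eulerGenus := by
  have hdisj : Disjoint T.sides C.sides := by
    rw [Set.disjoint_right]
    rintro e ⟨z, hz, rfl | rfl⟩ he
    · exact C.notMem_sides z hz he
    · have := T.a_mem_sides he
      rw [M.involutive] at this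
      exact C.notMem_sides z hz this
  have hextra : C.extra = (T.sides ∪ C.sides)ᶜ := by
    ext e; simp [extra]
  have h1 := Set.ncard_add_ncard_compl (T.sides ∪ C.sides)
  rw [← hextra, Set.ncard_union_eq hdisj, Nat.card_prod, Nat.card_fin] at h1
  have h2 := T.ncard_sides
  have h3 := C.ncard_sides
  have h4 := M.card_flag_le
  rw [M.card_allCells] at h2
  rw [eulerGenus, eulerChar]
  omega

/-- The vertices on the paths of the tree from the ends of the extra edges to the root. -/
def core : Set M.AllCells := {w | ∃ x i j, (x, i) ∈ C.extra ∧ j ≠ i ∧ T.Above (M.vert j x) w}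

/-- The core together with the paths of the tree from the three corners of `x` to the root. -/
def bag (x : M.Flag) : Set M.AllCells := {w | w ∈ C.core ∨ ∃ i, T.Above (M.vert i x) w}

/-- The connectivity axiom of a tree decomposition. A core vertex is in every bag. For any other
`w`, the triangles whose bags contain it are those with a corner below `w`; no extra edge ends below
`w`, so the non-tree sides joining these triangles are all crossed by the cotree. -/
theorem bag_connected (w : M.AllCells) (A : Set M.Flag)
    (hA : ∀ z, w ∈ C.bag z → w ∈ C.bag (C.par z) → (z ∈ A ↔ C.par z ∈ A)) (x y : M.Flag)
    (hx : w ∈ C.bag x) (hy : w ∈ C.bag y) (hxA : x ∈ A) : y ∈ A := by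
  by_cases hw : w ∈ C.core
  · have h (z) : z ∈ A ↔ C.root ∈ A := by
      induction hn : C.depth z using Nat.strong_induction_on generalizing z with
      | _ n ih =>
        by_cases hz : z = C.root
        · rw [hz]
        · rw [hA z (Or.inl hw) (Or.inl hw), ih _ (hn ▸ C.depth_par z hz) _ rfl]
    exact (h y).2 ((h x).1 hxA)
  · obtain ⟨j, hj⟩ := hx.resolve_left hw
    obtain ⟨k, hk⟩ := hy.resolve_left hw
    refine T.mem_of_above ?_ hj hk hxA
    intro z i l hli hl hT
    have hz : w ∈ C.bag z := Or.inr ⟨l, hl⟩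
    have hz' : w ∈ C.bag (M.a i z) := Or.inr ⟨l, by rwa [M.vert_a hli]⟩
    have hC : (z, i) ∈ C.sides := by
      by_contra hC
      exact hw ⟨z, i, l, ⟨hT, hC⟩, hli, hl⟩
    obtain ⟨u, hu, h | h⟩ := hC <;> rw [Prod.mk.injEq] at h <;> obtain ⟨rfl, rfl⟩ := h
    · rw [← C.par_eq _ hu] at hz' ⊢
      exact hA _ hz hz'
    · simp only [M.involutive] at hz' ⊢
      rw [← C.par_eq u hu] at hz ⊢
      exact (hA u hz' hz).symm

theorem ncard_bag_level_le (x : M.Flag) (l : ℕ) :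
    ((C.bag x ∩ {w | T.rank w = l}).ncard : ℤ) ≤ 2 * M.eulerGenus + 3 := by
  classical
  have := Fintype.ofFinite M.Flag
  have hpick (u) : ∃ w, ∀ w', T.Above u w' → T.rank w' = l → w' = w := by
    by_cases h : ∃ w, T.Above u w ∧ T.rank w = l
    · obtain ⟨w, hw, hwl⟩ := h
      exact ⟨w, fun w' hw' hl => T.eq_of_above_of_rank_eq hw' hw (hl.trans hwl.symm)⟩
    · push Not at h
      -- An arbitrary value, for a path that misses level `l`.
      exact ⟨u, fun w' h1 h2 => absurd h2 (h w' h1)⟩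
  choose pick hpick using hpick
  let P : Finset ((M.Flag × Fin 3) × Fin 3) :=
    Finset.univ.filter fun p => p.1 ∈ C.extra ∧ p.2 ≠ p.1.2
  let f (p : (M.Flag × Fin 3) × Fin 3) := pick (M.vert p.2 p.1.1)
  have hsub : C.bag x ∩ {w | T.rank w = l} ⊆
      ((P.image f ∪ Finset.univ.image fun i => pick (M.vert i x) : Finset M.AllCells) :
        Set M.AllCells) := by
    rintro w ⟨⟨y, i, j, hy, hji, hw⟩ | ⟨i, hw⟩, hl⟩
    · refine Finset.mem_coe.2 (Finset.mem_union_left _ (Finset.mem_image.2 ⟨((y, i), j), ?_, ?_⟩))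
      · exact Finset.mem_filter.2 ⟨Finset.mem_univ _, hy, hji⟩
      · exact (hpick _ _ hw hl).symm
    · exact Finset.mem_coe.2 (Finset.mem_union_right _ (Finset.mem_image.2
        ⟨i, Finset.mem_univ _, (hpick _ _ hw hl).symm⟩))
  have h1 := Set.ncard_le_ncard hsub
  rw [Set.ncard_coe_finset] at h1
  have h2 := Finset.card_union_le (P.image f) (Finset.univ.image fun i => pick (M.vert i x))
  have h3 : (Finset.univ.image fun i => pick (M.vert i x)).card ≤ 3 := Finset.card_image_le
  -- Each extra edge is listed from both of its triangles, with the same two ends, so `f` is at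
  -- least two-to-one. Two ends per side and at most `2g` extra sides, for Euler genus `g`, leave at
  -- most `2g` core vertices on the level.
  have h4 : 2 * (P.image f).card ≤ P.card := by
    refine Finset.mul_card_image_le_card _ 2 fun b hb => ?_
    obtain ⟨⟨⟨y, i⟩, j⟩, hp, rfl⟩ := Finset.mem_image.1 hb
    obtain ⟨-, hy, hji⟩ := Finset.mem_filter.1 hp
    have : ({((y, i), j), ((M.a i y, i), j)} : Finset ((M.Flag × Fin 3) × Fin 3)).card = 2 := by
      rw [Finset.card_pair]
      intro h
      exact M.no_boundary i y (Prod.ext_iff.1 (Prod.ext_iff.1 h).1).1.symm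
    rw [← this]
    refine Finset.card_le_card fun p hp' => ?_
    rcases Finset.mem_insert.1 hp' with rfl | hp'
    · exact Finset.mem_filter.2 ⟨hp, rfl⟩
    · rw [Finset.mem_singleton] at hp'
      subst hp'
      refine Finset.mem_filter.2 ⟨Finset.mem_filter.2 ⟨Finset.mem_univ _, C.a_mem_extra hy, hji⟩, ?_⟩
      simp only [f, M.vert_a hji]
  have h5 : P.card ≤ C.extra.ncard * 2 := by
    rw [Set.ncard_eq_toFinset_card']
    refine Finset.card_le_mul_card_image_of_maps_to (f := Prod.fst) (fun p hp => ?_) 2 (fun e _ => ?_)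
      |>.trans (by rw [mul_comm])
    · exact Set.mem_toFinset.2 (Finset.mem_filter.1 hp).2.1
    · calc _ ≤ ((Finset.univ.filter (· ≠ e.2)).image fun j => (e, j)).card := by
            refine Finset.card_le_card fun p hp => ?_
            obtain ⟨hpP, rfl⟩ := Finset.mem_filter.1 hp
            exact Finset.mem_image.2 ⟨p.2, Finset.mem_filter.2 ⟨Finset.mem_univ _,
              (Finset.mem_filter.1 hpP).2.2⟩, rfl⟩
        _ ≤ (Finset.univ.filter (· ≠ e.2)).card := Finset.card_image_le
        _ ≤ 2 := by generalize e.2 = i; revert i; decide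
  have h6 := C.ncard_extra_le
  omega

end RootedCotree

/-! ### Breadth-first tree of the barycentric subdivision -/

/-- A breadth-first spanning tree. -/
theorem exists_bfs_tree (M : CellSurface) : ∃ (T : M.RootedTree) (d : M.Cell 0 → ℕ),
    (∀ x, d (M.cell 0 (M.a 0 x)) ≤ d (M.cell 0 x) + 1) ∧
    (∀ c, T.rank ⟨0, c⟩ = 2 * d c) ∧
    ∀ x, T.Above (M.vert 1 x) (M.vert 0 x) ∨ T.Above (M.vert 1 x) (M.vert 0 (M.a 0 x)) := by
  obtain ⟨ρ⟩ := M.nonempty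
  obtain ⟨d, hd, hd'⟩ := exists_bfs_distance
    (fun u v => ∃ x, M.cell 0 x = u ∧ M.cell 0 (M.a 0 x) = v) (M.cell 0 ρ) (fun A hρ hA c => by
      obtain ⟨y, rfl⟩ := M.exists_cell_eq c
      refine M.mem_of_mem (A := {y | M.cell 0 y ∈ A}) (x := ρ) (fun j x hx => ?_) hρ y
      by_cases hj : 0 = j
      · subst hj
        exact hA _ _ ⟨x, rfl, rfl⟩ hx
      · simpa only [Set.mem_ofPred_eq, M.cell_a hj] using hx)
  -- Doubling the distance leaves odd ranks for the centres of edges and faces, each placed just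
  -- after its nearest incident vertex, which becomes its parent. A vertex of `M` other than the
  -- root has as parent the midpoint of an edge to a vertex one step closer.
  let R (w : M.AllCells) (n : ℕ) : Prop :=
    ∃ x, M.vert w.1 x = w ∧ n = 2 * d (M.cell 0 x) + if w.1 = 0 then 0 else 1
  have hR (w) : ∃ n, R w n := by
    obtain ⟨x, hx⟩ := M.exists_vert_eq w
    exact ⟨_, x, hx, rfl⟩
  let rank (w : M.AllCells) : ℕ := sInf {n | R w n}
  have hrank (w) : R w (rank w) := Nat.sInf_mem (hR w)
  have hrank_le (w n) (h : R w n) : rank w ≤ n := Nat.sInf_le h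
  have hrank0 (c : M.Cell 0) : rank ⟨0, c⟩ = 2 * d c := by
    obtain ⟨x, hx, hr⟩ := hrank ⟨0, c⟩
    have : M.cell 0 x = c := by simpa [vert] using hx
    simpa [this] using hr
  have hpar (w : M.AllCells) : ∃ p : M.AllCells × M.Flag × Fin 3,
      (w = M.vert 0 ρ → p.1 = w) ∧ (w ≠ M.vert 0 ρ → rank p.1 < rank w ∧ p.2.2 ≠ w.1 ∧
        M.vert w.1 p.2.1 = w ∧ (∀ j, j ≠ w.1 → j ≠ p.2.2 → M.vert j p.2.1 = p.1)) ∧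
      (w.1 ≠ 0 → M.vert w.1 p.2.1 = w ∧ p.1 = M.vert 0 p.2.1) := by
    by_cases hw : w = M.vert 0 ρ
    · exact ⟨(w, ρ, 0), fun _ => rfl, fun h => absurd hw h, fun h => absurd (by rw [hw]; rfl) h⟩
    by_cases h0 : w.1 = 0
    · obtain ⟨i, c⟩ := w
      obtain rfl : i = 0 := h0
      have hc : c ≠ M.cell 0 ρ := by
        rintro rfl; exact hw rfl
      obtain ⟨_, ⟨x, rfl, rfl⟩, hx⟩ := hd c hc
      refine ⟨(M.vert 1 (M.a 0 x), M.a 0 x, 2), fun h => absurd h hw,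
        fun _ => ⟨?_, (by decide : (2 : Fin 3) ≠ 0), rfl, ?_⟩, fun h => absurd rfl h⟩
      · refine (hrank_le (M.vert 1 (M.a 0 x)) (2 * d (M.cell 0 x) + 1)
          ⟨x, (M.vert_a (i := 1) (j := 0) (by decide) x).symm, rfl⟩).trans_lt ?_
        rw [hrank0]; omega
      · intro j h1 h2
        obtain rfl : j = 1 := by
          simp only at h1 h2
          revert h1 h2; revert j; decide
        rfl
    · obtain ⟨x, hx, hr⟩ := hrank w
      obtain ⟨k, hk, hk', hk0⟩ : ∃ k, k ≠ w.1 ∧ k ≠ 0 ∧ ∀ j, j ≠ w.1 → j ≠ k → j = 0 := by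
        revert h0; generalize w.1 = i; revert i; decide
      refine ⟨(M.vert 0 x, x, k), fun h => absurd h hw, fun _ => ⟨?_, hk, hx, ?_⟩,
        fun _ => ⟨hx, rfl⟩⟩
      · rw [hr, if_neg h0]
        have := hrank0 (M.cell 0 x)
        simp only [vert]
        omega
      · intro j h1 h2
        rw [hk0 j h1 h2]
  choose p hp1 hp2 hp3 using hpar
  refine ⟨⟨M.vert 0 ρ, fun w => (p w).1, rank, fun w => (p w).2.1, fun w => (p w).2.2,
    hp1 _ rfl, fun w hw => (hp2 w hw).1, fun w hw => (hp2 w hw).2.1, fun w hw => (hp2 w hw).2.2.1,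
    fun w hw => (hp2 w hw).2.2.2⟩, d, fun x => hd' _ _ ⟨x, rfl, rfl⟩, hrank0, fun x => ?_⟩
  obtain ⟨h1, h2⟩ := hp3 (M.vert 1 x) (by simp [vert])
  have h3 : M.vert 0 (p (M.vert 1 x)).2.1 = M.vert 0 x ∨
      M.vert 0 (p (M.vert 1 x)).2.1 = M.vert 0 (M.a 0 x) := by
    rcases M.eq_of_cell_one_eq (M.cell_eq_of_vert_eq (i := 1) h1.symm) with h | h | h | h <;>
      rw [h]
    · exact Or.inl rfl
    · exact Or.inr rfl
    · exact Or.inl (M.vert_a (by decide) x)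
    · exact Or.inr (by rw [M.comm, M.vert_a (by decide)])
  rw [← h2] at h3
  exact h3.imp (fun h => ⟨1, h⟩) (fun h => ⟨1, h⟩)

end CellSurface

/-! ### Assembling the layered separation -/

theorem mainTheorem2 {V : Type*} [Finite V] (G : SimpleGraph V) (g : ℕ)
    (hg : G.HasEulerGenus g) : G.AdmitsLayeredSeparations (2 * g + 3) := by
  obtain ⟨M, hM, f, hf, hG⟩ := hg.1
  obtain ⟨T, d, hd, hrank, hedge⟩ := M.exists_bfs_tree
  obtain ⟨C⟩ := CellSurface.RootedCotree.nonempty T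
  obtain ⟨L, hL⟩ := G.exists_layering_of_dist (fun v => d (f v)) (fun u v huv => by
    obtain ⟨x, hu, hv⟩ := hG v u huv.symm
    rw [← hu, ← hv]
    exact hd x)
  refine ⟨L, fun S => ?_⟩
  obtain ⟨x, G₁, G₂, hsep, hbag, h1, h2⟩ :=
    G.exists_separation_of_rooted_tree_decomposition C.root C.par C.depth C.par_root C.depth_par
      (fun z => {v | (⟨0, f v⟩ : M.AllCells) ∈ C.bag z})
      (fun v => by
        obtain ⟨x, hx⟩ := M.exists_cell_eq (f v)
        exact ⟨x, Or.inr ⟨0, by rw [CellSurface.vert, hx]; exact T.above_refl _⟩⟩)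
      (fun u v huv => by
        obtain ⟨x, hu, hv⟩ := hG u v huv
        have hu' : M.vert 0 x = ⟨0, f u⟩ := by rw [CellSurface.vert, hu]
        have hv' : M.vert 0 (M.a 0 x) = ⟨0, f v⟩ := by rw [CellSurface.vert, hv]
        -- A triangle has only one vertex of `M` as a corner. The path from the midpoint of the edge
        -- passes through one end, so the triangle at the other end has both ends in its bag.
        rcases hedge x with h | h
        · refine ⟨M.a 0 x, Or.inr ⟨1, ?_⟩, Or.inr ⟨0, ?_⟩⟩
          · rwa [M.vert_a (by decide), ← hu']
          · rw [hv']; exact T.above_refl _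
        · refine ⟨x, Or.inr ⟨0, ?_⟩, Or.inr ⟨1, ?_⟩⟩
          · rw [hu']; exact T.above_refl _
          · rwa [← hv'])
      (fun v A hA => C.bag_connected ⟨0, f v⟩ A hA) S
  refine ⟨G₁, G₂, hsep, fun i => ?_, ?_, ?_⟩
  · rw [hbag]
    rcases (L.layer i).eq_empty_or_nonempty with h0 | ⟨v₀, hv₀⟩
    · simp [h0]
    -- All vertices of a layer share one distance, so they lie on a single even level of the tree.
    · have hlev := C.ncard_bag_level_le x (2 * d (f v₀))
      have hinj : Function.Injective fun v => (⟨0, f v⟩ : M.AllCells) := by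
        intro u v h
        exact hf (by simpa using h)
      rw [hM] at hlev
      rw [← Set.ncard_image_of_injective _ hinj]
      refine le_trans (Set.ncard_le_ncard (t := C.bag x ∩ {w | T.rank w = 2 * d (f v₀)}) ?_)
        (by exact_mod_cast hlev)
      rintro _ ⟨v, ⟨hv, hvB⟩, rfl⟩
      refine ⟨hvB, ?_⟩
      have := hL v v₀ (hv.trans hv₀.symm)
      simp only [Set.mem_ofPred_eq, hrank, this]
  · have : (3 * ((G₁.verts \ G₂.verts) ∩ S).ncard : ℚ) ≤ 2 * S.ncard := by exact_mod_cast h1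
    linarith
  · have : (3 * ((G₂.verts \ G₁.verts) ∩ S).ncard : ℚ) ≤ 2 * S.ncard := by exact_mod_cast h2
    linarith
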